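/- Let $(\mathcal X,d_{\mathcal X})$ and $(\mathcal Y,d_{\mathcal Y})$ be separable metric spaces, $\mu$ a Borel probability measure on $\mathcal X\times\mathcal Y$, and $(X_1,Y_1),(X_2,Y_2),\dots$ independent random pairs with law $\mu$, defined on a common probability space. Fix $x_0\in\mathcal X$, $y_0\in\mathcal Y$, write $\|x\|=d_{\mathcal X}(x,x_0)$ and $\|y\|=d_{\mathcal Y}(y,y_0)$, and for $\beta>0$ put $\beta^*=\max(\beta,2\beta-2)$. For a Borel probability measure $\nu$ on $\mathcal X\times\mathcal Y$ and independent pairs $(X'_1,Y'_1),\dots,(X'_4,Y'_4)$ with law $\nu$, the $\beta$-distance covariance $\mathrm{DC}_\beta(\nu)$ is defined by either of $$\widehat{\mathrm{DC}}_\beta(\nu)=\tfrac14\,\mathbb E\big[\hat X\hat Y\big],\qquad \hat X=d(X'_1,X'_2)^\beta-d(X'_2,X'_3)^\beta+d(X'_3,X'_4)^\beta-d(X'_4,X'_1)^\beta,$$ $$\widetilde{\mathrm{DC}}_\beta(\nu)=\mathbb E\big[\tilde X\tilde Y\big],\qquad \tilde X=d(X'_1,X'_2)^\beta-\mathbb E_{X}\,d(X'_1,X)^\beta-\mathbb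 E_{X}\,d(X'_2,X)^\beta+\mathbb E\,d(X'_1,X'_2)^\beta,$$ with $\hat Y,\tilde Y$ defined in the same way from the $Y'_i$; here $\mathbb E_X$ denotes integration over $X$ only, where $X$ is distributed as the first marginal of $\nu$ and is independent of the $X'_i$. Let $\nu_n=\frac1n\sum_{i=1}^n\delta_{(X_i,Y_i)}$ be the empirical distribution of the first $n$ pairs. If $\beta>0$, $\mathbb E\|X_1\|^{\beta^*}<\infty$ and $\mathbb E\|Y_1\|^{\beta^*}<\infty$, then the expectations of $\hat X\hat Y$ and $\tilde X\tilde Y$ for $\nu=\mu$ exist and are finite, $\widehat{\mathrm{DC}}_\beta(\mu)=\widetilde{\mathrm{DC}}_\beta(\mu)$ (so that $\mathrm{DC}_\beta(\mu)$ is well defined), and, for each of the two definitions of $\mathrm{DC}_\beta$, $$\mathrm{DC}_\beta(\nu_n)\to\mathrm{DC}_\beta(\mu)\quad\text{almost surely as } n\to\infty .$$ In particular, for $\beta=1$ this holds as soon as $\mathbb E\|X_1\|<\infty$ and $\mathbb E\|Y_1\|<\infty$. -/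

import Mathlib

open MeasureTheory ProbabilityTheory Filter Topology
open scoped ENNReal

noncomputable section

/-- The moment exponent `β* = max (β, 2β - 2)`. -/
def betaStar (β : ℝ) : ℝ := max β (2 * β - 2)

/-- `d(x₁,x₂)^β - d(x₂,x₃)^β + d(x₃,x₄)^β - d(x₄,x₁)^β`, with points indexed from `0`. -/
def hatKernel {S : Type*} [MetricSpace S] (β : ℝ) (x : Fin 4 → S) : ℝ :=
  dist (x 0) (x 1) ^ β - dist (x 1) (x 2) ^ β + dist (x 2) (x 3) ^ β - dist (x 3) (x 0) ^ β

/-- The integrand of the four-point form of the distance covariance: the product of the two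
kernels of four points of the product space. -/
def hatIntegrand {S T : Type*} [MetricSpace S] [MetricSpace T] (β : ℝ)
    (z : Fin 4 → S × T) : ℝ :=
  hatKernel β (fun i => (z i).1) * hatKernel β (fun i => (z i).2)

/-- The distance covariance `(1/4) E[X̂ Ŷ]` of a law `μ`, from four independent copies. -/
def dcovHat {S T : Type*} [MetricSpace S] [MeasurableSpace S] [MetricSpace T]
    [MeasurableSpace T] (β : ℝ) (μ : Measure (S × T)) : ℝ :=
  (1 / 4) * ∫ z, hatIntegrand β z ∂(Measure.pi (fun _ : Fin 4 => μ))

/-- The doubly centred `β`-distance of `x` and `x'` under a law `m`: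
`d(x,x')^β - E d(x,X)^β - E d(x',X)^β + E d(X₁,X₂)^β`. -/
def tildeKernel {S : Type*} [MetricSpace S] [MeasurableSpace S] (β : ℝ) (m : Measure S)
    (x x' : S) : ℝ :=
  dist x x' ^ β - (∫ u, dist x u ^ β ∂m) - (∫ u, dist x' u ^ β ∂m)
    + ∫ u, ∫ v, dist u v ^ β ∂m ∂m

/-- The integrand of the doubly centred form of the distance covariance of `μ`, with the
centring done under the two marginals of `μ`. -/
def tildeIntegrand {S T : Type*} [MetricSpace S] [MeasurableSpace S] [MetricSpace T]
    [MeasurableSpace T] (β : ℝ) (μ : Measure (S × T)) (p : (S × T) × (S × T)) : ℝ :=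
  tildeKernel β μ.fst p.1.1 p.2.1 * tildeKernel β μ.snd p.1.2 p.2.2

/-- The distance covariance `E[X̃ Ỹ]` of a law `μ`, from two independent copies. -/
def dcovTilde {S T : Type*} [MetricSpace S] [MeasurableSpace S] [MetricSpace T]
    [MeasurableSpace T] (β : ℝ) (μ : Measure (S × T)) : ℝ :=
  ∫ p, tildeIntegrand β μ p ∂(μ.prod μ)

/-- The empirical distribution of the first `n` terms of a sequence (a probability measure
for `n ≥ 1`, the zero measure for `n = 0`). -/
def empiricalMeasure {E : Type*} [MeasurableSpace E] (z : ℕ → E) (n : ℕ) : Measure E :=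
  (n : ℝ≥0∞)⁻¹ • ∑ i ∈ Finset.range n, Measure.dirac (z i)

/-- The distance covariance of `μ` is well defined: the expectations in both of its forms
exist and are finite, and the two forms agree. -/
def DcovWellDefined {S T : Type*} [MetricSpace S] [MeasurableSpace S] [MetricSpace T]
    [MeasurableSpace T] (β : ℝ) (μ : Measure (S × T)) : Prop :=
  Integrable (hatIntegrand β) (Measure.pi (fun _ : Fin 4 => μ)) ∧
  Integrable (tildeIntegrand β μ) (μ.prod μ) ∧
  dcovHat β μ = dcovTilde β μ

end

set_option linter.unusedSectionVars false

/-! The four-point kernel cancels: its four distances form a cycle, and grouping edges that share a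
vertex bounds it by a constant times the product over the four points of `(1 + ‖x‖) ^ (β* / 2)`
(`abs_hatKernel_le`). Hence `|X̂ Ŷ|` is at most a constant times the product of `g (z i)`, where `g`
is the product of the two weights. The moment assumptions make `g` integrable by AM-GM, without any
joint moment condition.

Almost surely the empirical measures converge weakly, hence so do their fourth powers. By the strong
law the integral of the dominating function, a constant times `(∫ g) ^ 4`, converges too. Dominated
convergence along weak limits (`tendsto_integral_of_dominated_of_tendsto`) then gives consistency of
the four-point form.

The four-point kernel is also an alternating sum of doubly centred kernels over the edges of the
cycle. Products over distinct edges integrate to zero, so the two forms agree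
(`dcovHat_eq_dcovTilde`). This applies to empirical measures as well, which transfers consistency to
the centred form. -/

/-! ### Elementary inequalities for differences of powers -/

lemma rpow_sub_rpow_le_mul {u v β : ℝ} (hv : 0 ≤ v) (hvu : v ≤ u) (hβ : 1 ≤ β) :
    u ^ β - v ^ β ≤ β * u ^ (β - 1) * (u - v) := by
  rcases (hv.trans hvu).eq_or_lt with h | hu
  · obtain rfl : v = u := le_antisymm hvu (h ▸ hv)
    simp
  -- Bernoulli's inequality at `v / u`; scaling by `u ^ β` gives the tangent line bound at `u`.
  have h1 : 1 + β * (v / u - 1) ≤ (v / u) ^ β := by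
    have h := one_add_mul_self_le_rpow_one_add (s := v / u - 1)
      (by have := div_nonneg hv hu.le; linarith) hβ
    simpa using h
  have h2 : u ^ β = u ^ (β - 1) * u := by
    rw [← Real.rpow_add_one hu.ne', sub_add_cancel]
  have h3 := mul_le_mul_of_nonneg_right h1 (Real.rpow_nonneg hu.le β)
  rw [Real.div_rpow hv hu.le, div_mul_cancel₀ _ (Real.rpow_pos_of_pos hu β).ne'] at h3
  have h4 : (1 + β * (v / u - 1)) * u ^ β = u ^ β + β * u ^ (β - 1) * (v - u) := by
    rw [h2]
    field_simp
  rw [h4] at h3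
  linarith

/-- This is where `β*` comes from. For `β ≥ 2` both exponents, `β - 1` and `1`, are at most `β* /
2`. For `β ≤ 2` a factor `n ^ (1 - β / 2)` is traded for the larger `m ^ (1 - β / 2)`, which
balances the exponents at `β / 2`. -/
lemma rpow_sub_one_mul_le {β n m : ℝ} (hn : 1 ≤ n) (hnm : n ≤ m) :
    m ^ (β - 1) * n ≤ (n * m) ^ (betaStar β / 2) := by
  have hm : 1 ≤ m := hn.trans hnm
  have hn0 : 0 < n := by linarith
  have hm0 : 0 < m := by linarith
  have g1 : β / 2 ≤ betaStar β / 2 := by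
    have := le_max_left β (2 * β - 2)
    unfold betaStar; linarith
  have g2 : β - 1 ≤ betaStar β / 2 := by
    have := le_max_right β (2 * β - 2)
    unfold betaStar; linarith
  rw [Real.mul_rpow hn0.le hm0.le]
  rcases le_total 2 β with h | h
  · have e1 : n ≤ n ^ (betaStar β / 2) := by
      simpa using Real.rpow_le_rpow_of_exponent_le hn (show (1 : ℝ) ≤ betaStar β / 2 by linarith)
    rw [mul_comm]
    exact mul_le_mul e1 (Real.rpow_le_rpow_of_exponent_le hm g2) (by positivity) (by positivity)
  · have e1 : n = n ^ (β / 2) * n ^ (1 - β / 2) := by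
      rw [← Real.rpow_add hn0]; simp
    have e2 : m ^ (β / 2) = m ^ (β - 1) * m ^ (1 - β / 2) := by
      rw [← Real.rpow_add hm0]; congr 1; ring
    calc m ^ (β - 1) * n = m ^ (β - 1) * (n ^ (β / 2) * n ^ (1 - β / 2)) := by rw [← e1]
      _ ≤ m ^ (β - 1) * (n ^ (β / 2) * m ^ (1 - β / 2)) := by
        gcongr; linarith
      _ = n ^ (β / 2) * m ^ (β / 2) := by rw [e2]; ring
      _ ≤ _ := by gcongr

/-- Subadditivity of the power for `β ≤ 1`, the tangent line bound for `β ≥ 1`. The gain over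
bounding each power separately is that the gap is governed by the smaller scale `n`. -/
lemma abs_rpow_sub_rpow_le {β u v n m : ℝ} (hβ : 0 < β) (hu : 0 ≤ u) (hv : 0 ≤ v)
    (hum : u ≤ 2 * m) (hvm : v ≤ 2 * m) (huv : |u - v| ≤ 2 * n) (hn : 1 ≤ n) (hnm : n ≤ m) :
    |u ^ β - v ^ β| ≤ max 1 β * 2 ^ β * (n * m) ^ (betaStar β / 2) := by
  wlog hle : v ≤ u generalizing u v
  · rw [abs_sub_comm]
    exact this hv hu hvm hum (by rwa [abs_sub_comm]) (le_of_not_ge hle)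
  have hn0 : 0 < n := by linarith
  have hm0 : 0 < m := by linarith
  have huv' : u - v ≤ 2 * n := (le_abs_self _).trans huv
  have hmono : v ^ β ≤ u ^ β := Real.rpow_le_rpow hv hle hβ.le
  rw [abs_of_nonneg (by linarith)]
  rcases le_total β 1 with h | h
  · have h1 : u ^ β ≤ v ^ β + (u - v) ^ β := by
      simpa using Real.rpow_add_le_add_rpow hv (sub_nonneg.2 hle) hβ.le h
    calc u ^ β - v ^ β ≤ (u - v) ^ β := by linarith
      _ ≤ (2 * n) ^ β := Real.rpow_le_rpow (sub_nonneg.2 hle) huv' hβ.le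
      _ = 1 * 2 ^ β * n ^ β := by rw [Real.mul_rpow (by norm_num) hn0.le]; ring
      _ = 1 * 2 ^ β * (n * n) ^ (β / 2) := by
        rw [Real.mul_rpow hn0.le hn0.le, ← Real.rpow_add hn0]; ring_nf
      _ ≤ max 1 β * 2 ^ β * (n * m) ^ (β / 2) := by
        gcongr; exact le_max_left _ _
      _ ≤ _ := by
        gcongr
        · nlinarith
        · exact le_max_left _ _
  · calc u ^ β - v ^ β ≤ β * u ^ (β - 1) * (u - v) := rpow_sub_rpow_le_mul hv hle h
      _ ≤ β * (2 * m) ^ (β - 1) * (2 * n) := by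
        gcongr
      _ = β * 2 ^ β * (m ^ (β - 1) * n) := by
        rw [Real.mul_rpow (by norm_num) hm0.le, Real.rpow_sub_one (by norm_num)]; ring
      _ ≤ _ := by
        gcongr
        · exact le_max_right _ _
        · exact rpow_sub_one_mul_le hn hnm

/-- The weight `(1 + d(x, x₀)) ^ (β* / 2)`, whose square has the growth of `d(x, x₀) ^ β*`. -/
noncomputable def momentWeight {S : Type*} [MetricSpace S] (β : ℝ) (x₀ x : S) : ℝ :=
  (1 + dist x x₀) ^ (betaStar β / 2)

/-! ### Growth of the four-point kernel -/

section weight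

variable {S : Type*} [MetricSpace S] {β : ℝ}

lemma le_betaStar (β : ℝ) : β ≤ betaStar β := le_max_left _ _

lemma one_le_momentWeight (hβ : 0 < β) (x₀ x : S) : 1 ≤ momentWeight β x₀ x :=
  Real.one_le_rpow (by linarith [dist_nonneg (x := x) (y := x₀)])
    (by linarith [le_betaStar β])

lemma momentWeight_pos (hβ : 0 < β) (x₀ x : S) : 0 < momentWeight β x₀ x :=
  one_pos.trans_le (one_le_momentWeight hβ x₀ x)

lemma continuous_momentWeight (hβ : 0 < β) (x₀ : S) : Continuous (momentWeight β x₀) := by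
  unfold momentWeight
  exact (by fun_prop : Continuous fun x : S => 1 + dist x x₀).rpow_const
    fun x => Or.inr (by linarith [le_betaStar β])

lemma momentWeight_sq (x₀ x : S) :
    momentWeight β x₀ x ^ 2 = (1 + dist x x₀) ^ betaStar β := by
  have h : 0 ≤ 1 + dist x x₀ := by positivity
  rw [momentWeight, ← Real.rpow_natCast, ← Real.rpow_mul h]
  norm_num

/-- The constant in the bound of `hatKernel` by the product of the weights. -/
noncomputable def kernelConst (β : ℝ) : ℝ := 2 * (max 1 β * 2 ^ β)

lemma kernelConst_pos (β : ℝ) : 0 < kernelConst β := by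
  have : 0 < max 1 β := lt_max_of_lt_left one_pos
  unfold kernelConst; positivity

/-- Points 0, 2 and points 1, 3 are the opposite pairs of the cycle, with scales `M` and `N`. Edges
are grouped at the vertices of the pair with the larger scale: two edges meeting there differ by at
most the distance within the other pair, hence by at most twice the smaller scale. Each scale is at
most the product over its pair because all factors are at least 1. -/
lemma abs_hatKernel_le (hβ : 0 < β) (x₀ : S) (x : Fin 4 → S) :
    |hatKernel β x| ≤ kernelConst β * ∏ i, momentWeight β x₀ (x i) := by
  have hA (i) : 1 ≤ 1 + dist (x i) x₀ := by linarith [dist_nonneg (x := x i) (y := x₀)]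
  have hd (i j) : dist (x i) (x j) ≤ dist (x i) x₀ + dist (x j) x₀ := dist_triangle_right _ _ _
  have hab (i j k) : |dist (x i) (x j) - dist (x i) (x k)| ≤ dist (x j) (x k) := by
    simpa [dist_comm] using abs_dist_sub_le (x j) (x k) (x i)
  set A : Fin 4 → ℝ := fun i => 1 + dist (x i) x₀ with hAdef
  have hP : ∏ i, momentWeight β x₀ (x i) = ((A 0 * A 2) * (A 1 * A 3)) ^ (betaStar β / 2) := by
    have h0 (i) : 0 ≤ A i := zero_le_one.trans (hA i)
    rw [Fin.prod_univ_four, Real.mul_rpow, Real.mul_rpow, Real.mul_rpow]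
    · simp only [momentWeight, hAdef]; ring
    all_goals first | exact h0 _ | exact mul_nonneg (h0 _) (h0 _)
  have hb : 0 ≤ betaStar β / 2 := by linarith [le_betaStar β]
  have h1 : max (A 0) (A 2) ≤ A 0 * A 2 :=
    max_le (le_mul_of_one_le_right (by linarith [hA 0]) (hA 2))
      (le_mul_of_one_le_left (by linarith [hA 2]) (hA 0))
  have h2 : max (A 1) (A 3) ≤ A 1 * A 3 :=
    max_le (le_mul_of_one_le_right (by linarith [hA 1]) (hA 3))
      (le_mul_of_one_le_left (by linarith [hA 3]) (hA 1))
  have l0 := le_max_left (A 0) (A 2)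
  have l2 := le_max_right (A 0) (A 2)
  have l1 := le_max_left (A 1) (A 3)
  have l3 := le_max_right (A 1) (A 3)
  set M := max (A 0) (A 2)
  set N := max (A 1) (A 3)
  have hM : 1 ≤ M := (hA 0).trans l0
  have hN : 1 ≤ N := (hA 1).trans l1
  have hMN : max 1 β * 2 ^ β * (M * N) ^ (betaStar β / 2)
      ≤ max 1 β * 2 ^ β * ∏ i, momentWeight β x₀ (x i) := by
    rw [hP]
    have : 0 < max 1 β := lt_max_of_lt_left one_pos
    gcongr
  have d01 := hd 0 1
  have d12 := hd 1 2
  have d23 := hd 2 3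
  have d30 := hd 3 0
  have d13 := hd 1 3
  have d02 := hd 0 2
  simp only [hAdef] at l0 l1 l2 l3
  rw [kernelConst, mul_assoc]
  rcases le_total N M with h | h
  · have e1 := abs_rpow_sub_rpow_le hβ (u := dist (x 0) (x 1)) (v := dist (x 3) (x 0)) (n := N)
      (m := M) dist_nonneg dist_nonneg (by linarith) (by linarith)
      (by rw [dist_comm (x 3)]; linarith [hab 0 1 3]) hN h
    have e2 := abs_rpow_sub_rpow_le hβ (u := dist (x 2) (x 3)) (v := dist (x 1) (x 2)) (n := N)
      (m := M) dist_nonneg dist_nonneg (by linarith) (by linarith)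
      (by rw [dist_comm (x 1)]; linarith [hab 2 3 1, dist_comm (x 3) (x 1)]) hN h
    rw [mul_comm N M] at e1 e2
    calc |hatKernel β x| = |(dist (x 0) (x 1) ^ β - dist (x 3) (x 0) ^ β)
          + (dist (x 2) (x 3) ^ β - dist (x 1) (x 2) ^ β)| := by
          unfold hatKernel; congr 1; ring
      _ ≤ _ := abs_add_le _ _
      _ ≤ _ := by linarith
  · have e1 := abs_rpow_sub_rpow_le hβ (u := dist (x 0) (x 1)) (v := dist (x 1) (x 2)) (n := M)
      (m := N) dist_nonneg dist_nonneg (by linarith) (by linarith)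
      (by rw [dist_comm (x 0)]; linarith [hab 1 0 2]) hM h
    have e2 := abs_rpow_sub_rpow_le hβ (u := dist (x 2) (x 3)) (v := dist (x 3) (x 0)) (n := M)
      (m := N) dist_nonneg dist_nonneg (by linarith) (by linarith)
      (by rw [dist_comm (x 2)]; linarith [hab 3 2 0, dist_comm (x 2) (x 0)]) hM h
    calc |hatKernel β x| = |(dist (x 0) (x 1) ^ β - dist (x 1) (x 2) ^ β)
          + (dist (x 2) (x 3) ^ β - dist (x 3) (x 0) ^ β)| := by
          unfold hatKernel; congr 1; ring
      _ ≤ _ := abs_add_le _ _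
      _ ≤ _ := by linarith

/-- A crude bound without cancellation, sufficient for the integrability of single distances. -/
lemma dist_rpow_le (hβ : 0 < β) (x₀ x y : S) :
    dist x y ^ β ≤ 2 ^ β * (momentWeight β x₀ x ^ 2 * momentWeight β x₀ y ^ 2) := by
  have hx : 1 ≤ 1 + dist x x₀ := by linarith [dist_nonneg (x := x) (y := x₀)]
  have hy : 1 ≤ 1 + dist y x₀ := by linarith [dist_nonneg (x := y) (y := x₀)]
  have h : dist x y ≤ 2 * ((1 + dist x x₀) * (1 + dist y x₀)) := by
    nlinarith [dist_triangle_right x y x₀, dist_nonneg (x := x) (y := x₀),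
      dist_nonneg (x := y) (y := x₀)]
  calc dist x y ^ β ≤ (2 * ((1 + dist x x₀) * (1 + dist y x₀))) ^ β :=
        Real.rpow_le_rpow dist_nonneg h hβ.le
    _ = 2 ^ β * ((1 + dist x x₀) ^ β * (1 + dist y x₀) ^ β) := by
        rw [Real.mul_rpow (by norm_num) (by positivity), Real.mul_rpow (by positivity)
          (by positivity)]
    _ ≤ _ := by
        rw [momentWeight_sq, momentWeight_sq]
        gcongr <;> first | assumption | exact le_betaStar β

lemma continuous_hatKernel (hβ : 0 < β) : Continuous (hatKernel β : (Fin 4 → S) → ℝ) := by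
  have h (i j : Fin 4) : Continuous fun x : Fin 4 → S => dist (x i) (x j) ^ β :=
    (by fun_prop : Continuous fun x : Fin 4 → S => dist (x i) (x j)).rpow_const
      fun _ => Or.inr hβ.le
  exact (((h 0 1).sub (h 1 2)).add (h 2 3)).sub (h 3 0)

end weight

lemma integral_const_sub_add_sub_const {E : Type*} [MeasurableSpace E] {m : Measure E}
    [IsProbabilityMeasure m] {f g : E → ℝ} (hf : Integrable f m) (hg : Integrable g m)
    (a b : ℝ) : ∫ x, (a - f x + g x - b) ∂m = a - ∫ x, f x ∂m + ∫ x, g x ∂m - b := by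
  have h1 : Integrable (fun x => a - f x) m := (integrable_const a).sub hf
  have h2 : Integrable (fun x => a - f x + g x) m := h1.add hg
  rw [integral_sub h2 (integrable_const _), integral_add h1 hg, integral_sub (integrable_const _) hf]
  simp

/-! ### The doubly centred kernel under one marginal -/

section marginal

variable {S : Type*} [MetricSpace S] [SecondCountableTopology S] [MeasurableSpace S]
  [BorelSpace S] {β : ℝ} {x₀ : S} {m : Measure S} [IsProbabilityMeasure m]

lemma integrable_momentWeight_of_sq (hβ : 0 < β)
    (hm : Integrable (fun x => momentWeight β x₀ x ^ 2) m) : Integrable (momentWeight β x₀) m := by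
  refine hm.mono' (continuous_momentWeight hβ x₀).aestronglyMeasurable (.of_forall fun x => ?_)
  have h := one_le_momentWeight hβ x₀ x
  rw [Real.norm_of_nonneg (by linarith)]
  nlinarith

lemma continuous_dist_rpow (hβ : 0 < β) : Continuous fun p : S × S => dist p.1 p.2 ^ β :=
  (by fun_prop : Continuous fun p : S × S => dist p.1 p.2).rpow_const fun _ => Or.inr hβ.le

lemma integrable_dist_rpow_prod (hβ : 0 < β)
    (hm : Integrable (fun x => momentWeight β x₀ x ^ 2) m) :
    Integrable (fun p : S × S => dist p.1 p.2 ^ β) (m.prod m) := by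
  refine ((hm.mul_prod hm).const_mul (2 ^ β)).mono'
    (continuous_dist_rpow hβ).aestronglyMeasurable (.of_forall fun p => ?_)
  rw [Real.norm_of_nonneg (by positivity)]
  exact dist_rpow_le hβ x₀ _ _

lemma integrable_dist_rpow (hβ : 0 < β)
    (hm : Integrable (fun x => momentWeight β x₀ x ^ 2) m) (x : S) :
    Integrable (fun u => dist x u ^ β) m := by
  refine ((hm.const_mul (momentWeight β x₀ x ^ 2)).const_mul (2 ^ β)).mono'
    ((continuous_dist_rpow hβ).comp (by fun_prop : Continuous fun u => (x, u))).aestronglyMeasurable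
    (.of_forall fun u => ?_)
  rw [Real.norm_of_nonneg (by positivity)]
  exact dist_rpow_le hβ x₀ _ _

lemma tildeKernel_comm (x y : S) : tildeKernel β m x y = tildeKernel β m y x := by
  unfold tildeKernel
  rw [dist_comm]
  ring

lemma measurable_tildeKernel (hβ : 0 < β) :
    Measurable fun p : S × S => tildeKernel β m p.1 p.2 := by
  have h : Measurable fun x : S => ∫ u, dist x u ^ β ∂m :=
    (StronglyMeasurable.integral_prod_right
      (continuous_dist_rpow hβ).stronglyMeasurable).measurable
  exact (((continuous_dist_rpow hβ).measurable.sub (h.comp measurable_fst)).sub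
    (h.comp measurable_snd)).add_const _

lemma integral_tildeKernel_right (hβ : 0 < β)
    (hm : Integrable (fun x => momentWeight β x₀ x ^ 2) m) (x : S) :
    ∫ y, tildeKernel β m x y ∂m = 0 := by
  have h1 := integrable_dist_rpow hβ hm x
  have h2 : Integrable (fun y => ∫ u, dist y u ^ β ∂m) m :=
    (integrable_dist_rpow_prod hβ hm).integral_prod_left
  calc ∫ y, tildeKernel β m x y ∂m
      = ∫ y, ((∫ u, ∫ v, dist u v ^ β ∂m ∂m) - (∫ u, dist y u ^ β ∂m) + dist x y ^ β
          - ∫ u, dist x u ^ β ∂m) ∂m :=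
        integral_congr_ae (.of_forall fun y => by simp only [tildeKernel]; ring)
    _ = 0 := by rw [integral_const_sub_add_sub_const h2 h1]; ring

/-- The centred kernel is the four-point kernel averaged over its last two points, so it inherits
the product bound. -/
lemma abs_tildeKernel_le (hβ : 0 < β)
    (hm : Integrable (fun x => momentWeight β x₀ x ^ 2) m) (x y : S) :
    |tildeKernel β m x y| ≤ kernelConst β * (∫ u, momentWeight β x₀ u ∂m) ^ 2
      * (momentWeight β x₀ x * momentWeight β x₀ y) := by
  have hw := integrable_momentWeight_of_sq hβ hm
  have hφ : Integrable (fun y => ∫ u, dist y u ^ β ∂m) m :=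
    (integrable_dist_rpow_prod hβ hm).integral_prod_left
  have hin (u : S) : ∫ v, hatKernel β ![x, y, u, v] ∂m
      = dist x y ^ β - dist y u ^ β + (∫ v, dist u v ^ β ∂m) - ∫ v, dist x v ^ β ∂m := by
    have h1 := integrable_dist_rpow hβ hm u
    have h2 := integrable_dist_rpow hβ hm x
    have e (v : S) : hatKernel β ![x, y, u, v]
        = dist x y ^ β - dist x v ^ β + dist u v ^ β - dist y u ^ β := by
      simp [hatKernel, dist_comm v x]
      ring
    simp only [e]
    rw [integral_const_sub_add_sub_const h2 h1]
    ring
  have hout : ∫ u, ∫ v, hatKernel β ![x, y, u, v] ∂m ∂m = tildeKernel β m x y := by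
    have h1 := integrable_dist_rpow hβ hm y
    simp only [hin]
    rw [integral_const_sub_add_sub_const h1 hφ, tildeKernel]
    ring
  have hb (u : S) : ‖∫ v, hatKernel β ![x, y, u, v] ∂m‖ ≤ kernelConst β
      * (momentWeight β x₀ x * momentWeight β x₀ y) * (∫ v, momentWeight β x₀ v ∂m)
        * momentWeight β x₀ u := by
    refine (norm_integral_le_of_norm_le (hw.const_mul (kernelConst β
      * (momentWeight β x₀ x * momentWeight β x₀ y) * momentWeight β x₀ u))
      (.of_forall fun v => ?_)).trans_eq ?_
    · refine (abs_hatKernel_le hβ x₀ _).trans_eq ?_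
      simp [Fin.prod_univ_four]
      ring
    · rw [integral_const_mul]
      ring
  rw [← hout, ← Real.norm_eq_abs]
  refine (norm_integral_le_of_norm_le (hw.const_mul _) (.of_forall hb)).trans_eq ?_
  rw [integral_const_mul]
  ring

end marginal

lemma mul_le_prod_of_one_le {ι : Type*} [Fintype ι] {f : ι → ℝ} (hf : ∀ i, 1 ≤ f i) {i j : ι}
    (hij : i ≠ j) : f i * f j ≤ ∏ k, f k := by
  classical
  rw [← Finset.prod_pair hij]
  exact Finset.prod_le_prod_of_subset_of_one_le (Finset.subset_univ _)
    (fun k _ => zero_le_one.trans (hf k)) fun k _ _ => hf k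

/-! ### Integrability and equality of the two forms -/

section joint

variable {S T : Type*} [MetricSpace S] [SecondCountableTopology S] [MeasurableSpace S]
  [BorelSpace S] [MetricSpace T] [SecondCountableTopology T] [MeasurableSpace T] [BorelSpace T]
  {β : ℝ} {x₀ : S} {y₀ : T} {ν : Measure (S × T)} [IsProbabilityMeasure ν]

lemma map_eval_pair_pi {E ι : Type*} [MeasurableSpace E] [Fintype ι] (ν : Measure E)
    [IsProbabilityMeasure ν] {i j : ι} (hij : i ≠ j) :
    (Measure.pi fun _ : ι => ν).map (fun z => (z i, z j)) = ν.prod ν := by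
  have h : iIndepFun (fun (k : ι) (z : ι → E) => z k) (Measure.pi fun _ : ι => ν) :=
    iIndepFun_pi (X := fun _ : ι => (id : E → E)) fun _ => aemeasurable_id
  rw [(indepFun_iff_map_prod_eq_prod_map_map (measurable_pi_apply i).aemeasurable
    (measurable_pi_apply j).aemeasurable).1 (h.indepFun hij)]
  have e (k : ι) : (Measure.pi fun _ : ι => ν).map (fun z => z k) = ν :=
    (measurePreserving_eval (fun _ : ι => ν) k).map_eq
  rw [e, e]

lemma continuous_hatIntegrand (hβ : 0 < β) :
    Continuous (hatIntegrand β : (Fin 4 → S × T) → ℝ) := by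
  unfold hatIntegrand
  exact ((continuous_hatKernel hβ).comp (by fun_prop)).mul
    ((continuous_hatKernel hβ).comp (by fun_prop))

lemma abs_hatIntegrand_le (hβ : 0 < β) (x₀ : S) (y₀ : T) (z : Fin 4 → S × T) :
    |hatIntegrand β z| ≤ kernelConst β ^ 2 *
      ∏ i, (momentWeight β x₀ (z i).1 * momentWeight β y₀ (z i).2) := by
  rw [hatIntegrand, abs_mul, Finset.prod_mul_distrib]
  have h1 := abs_hatKernel_le hβ x₀ fun i => (z i).1
  have h2 := abs_hatKernel_le hβ y₀ fun i => (z i).2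
  calc _ ≤ _ := mul_le_mul h1 h2 (abs_nonneg _) ((abs_nonneg _).trans h1)
    _ = _ := by ring

/-- AM-GM: the product of the weights is dominated by the sum of their squares. -/
lemma integrable_momentWeight_mul (hβ : 0 < β)
    (hx : Integrable (fun z : S × T => momentWeight β x₀ z.1 ^ 2) ν)
    (hy : Integrable (fun z : S × T => momentWeight β y₀ z.2 ^ 2) ν) :
    Integrable (fun z : S × T => momentWeight β x₀ z.1 * momentWeight β y₀ z.2) ν := by
  have c1 := (continuous_momentWeight hβ x₀).comp (continuous_fst (X := S) (Y := T))
  have c2 := (continuous_momentWeight hβ y₀).comp (continuous_snd (X := S) (Y := T))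
  refine (hx.add hy).mono' (c1.mul c2).aestronglyMeasurable (.of_forall fun z => ?_)
  have h1 := momentWeight_pos hβ x₀ z.1
  have h2 := momentWeight_pos hβ y₀ z.2
  rw [Real.norm_of_nonneg (by positivity)]
  simp only [Pi.add_apply]
  nlinarith [sq_nonneg (momentWeight β x₀ z.1 - momentWeight β y₀ z.2)]

lemma integrable_hatIntegrand (hβ : 0 < β)
    (hx : Integrable (fun z : S × T => momentWeight β x₀ z.1 ^ 2) ν)
    (hy : Integrable (fun z : S × T => momentWeight β y₀ z.2 ^ 2) ν) :
    Integrable (hatIntegrand β) (Measure.pi fun _ : Fin 4 => ν) :=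
  ((Integrable.fintype_prod fun _ => integrable_momentWeight_mul hβ hx hy).const_mul _).mono'
    (continuous_hatIntegrand hβ).aestronglyMeasurable (.of_forall (abs_hatIntegrand_le hβ x₀ y₀))

lemma integrable_momentWeight_sq_fst (hβ : 0 < β)
    (hx : Integrable (fun z : S × T => momentWeight β x₀ z.1 ^ 2) ν) :
    Integrable (fun x => momentWeight β x₀ x ^ 2) ν.fst :=
  (integrable_map_measure ((continuous_momentWeight hβ x₀).pow 2).aestronglyMeasurable
    measurable_fst.aemeasurable).2 hx

lemma integrable_momentWeight_sq_snd (hβ : 0 < β)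
    (hy : Integrable (fun z : S × T => momentWeight β y₀ z.2 ^ 2) ν) :
    Integrable (fun y => momentWeight β y₀ y ^ 2) ν.snd :=
  (integrable_map_measure ((continuous_momentWeight hβ y₀).pow 2).aestronglyMeasurable
    measurable_snd.aemeasurable).2 hy

lemma measurable_tildeKernel_mul (hβ : 0 < β) (i j k l : Fin 4) :
    Measurable fun z : Fin 4 → S × T =>
      tildeKernel β ν.fst (z i).1 (z j).1 * tildeKernel β ν.snd (z k).2 (z l).2 :=
  ((measurable_tildeKernel (m := ν.fst) hβ).comp
      (by fun_prop : Measurable fun z : Fin 4 → S × T => ((z i).1, (z j).1))).mul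
    ((measurable_tildeKernel (m := ν.snd) hβ).comp
      (by fun_prop : Measurable fun z : Fin 4 → S × T => ((z k).2, (z l).2)))

lemma exists_abs_tildeKernel_mul_le (hβ : 0 < β)
    (hx : Integrable (fun z : S × T => momentWeight β x₀ z.1 ^ 2) ν)
    (hy : Integrable (fun z : S × T => momentWeight β y₀ z.2 ^ 2) ν) :
    ∃ C : ℝ, 0 ≤ C ∧ ∀ (x x' : S) (y y' : T),
      |tildeKernel β ν.fst x x' * tildeKernel β ν.snd y y'| ≤
        C * ((momentWeight β x₀ x * momentWeight β x₀ x')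
          * (momentWeight β y₀ y * momentWeight β y₀ y')) := by
  have hc := kernelConst_pos β
  refine ⟨kernelConst β * (∫ u, momentWeight β x₀ u ∂ν.fst) ^ 2
    * (kernelConst β * (∫ u, momentWeight β y₀ u ∂ν.snd) ^ 2), by positivity, fun x x' y y' => ?_⟩
  have h1 := abs_tildeKernel_le hβ (integrable_momentWeight_sq_fst hβ hx) x x'
  have h2 := abs_tildeKernel_le hβ (integrable_momentWeight_sq_snd hβ hy) y y'
  rw [abs_mul]
  calc _ ≤ _ := mul_le_mul h1 h2 (abs_nonneg _) ((abs_nonneg _).trans h1)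
    _ = _ := by ring

/-- The pairs may overlap. Since all weights are at least 1, each pair can be completed to the
product over all four points, and the bound becomes a product of integrable functions of independent
coordinates. -/
lemma integrable_tildeKernel_mul (hβ : 0 < β)
    (hx : Integrable (fun z : S × T => momentWeight β x₀ z.1 ^ 2) ν)
    (hy : Integrable (fun z : S × T => momentWeight β y₀ z.2 ^ 2) ν)
    {i j k l : Fin 4} (hij : i ≠ j) (hkl : k ≠ l) :
    Integrable (fun z : Fin 4 → S × T =>
      tildeKernel β ν.fst (z i).1 (z j).1 * tildeKernel β ν.snd (z k).2 (z l).2)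
      (Measure.pi fun _ : Fin 4 => ν) := by
  obtain ⟨C, hC, hb⟩ := exists_abs_tildeKernel_mul_le hβ hx hy
  refine ((Integrable.fintype_prod fun _ : Fin 4 =>
    integrable_momentWeight_mul hβ hx hy).const_mul C).mono'
    (measurable_tildeKernel_mul hβ i j k l).aestronglyMeasurable (.of_forall fun z => ?_)
  refine (hb _ _ _ _).trans ?_
  rw [Finset.prod_mul_distrib]
  have p1 (i) := one_le_momentWeight hβ x₀ (z i).1
  have p2 (i) := one_le_momentWeight hβ y₀ (z i).2
  refine mul_le_mul_of_nonneg_left (mul_le_mul (mul_le_prod_of_one_le p1 hij)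
    (mul_le_prod_of_one_le p2 hkl) ?_ ?_) hC
  · exact mul_nonneg (momentWeight_pos hβ _ _).le (momentWeight_pos hβ _ _).le
  · exact Finset.prod_nonneg fun i _ => (momentWeight_pos hβ _ _).le

lemma integrable_tildeIntegrand (hβ : 0 < β)
    (hx : Integrable (fun z : S × T => momentWeight β x₀ z.1 ^ 2) ν)
    (hy : Integrable (fun z : S × T => momentWeight β y₀ z.2 ^ 2) ν) :
    Integrable (tildeIntegrand β ν) (ν.prod ν) := by
  obtain ⟨C, hC, hb⟩ := exists_abs_tildeKernel_mul_le hβ hx hy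
  have hm : Measurable (tildeIntegrand β ν) :=
    ((measurable_tildeKernel (m := ν.fst) hβ).comp
      (by fun_prop : Measurable fun p : (S × T) × (S × T) => (p.1.1, p.2.1))).mul
    ((measurable_tildeKernel (m := ν.snd) hβ).comp
      (by fun_prop : Measurable fun p : (S × T) × (S × T) => (p.1.2, p.2.2)))
  have hg := integrable_momentWeight_mul hβ hx hy
  refine ((hg.mul_prod hg).const_mul C).mono' hm.aestronglyMeasurable (.of_forall fun p => ?_)
  refine (hb _ _ _ _).trans_eq ?_
  ring

lemma integral_tildeKernel_mul_self (hβ : 0 < β) {i j : Fin 4} (hij : i ≠ j) :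
    ∫ z : Fin 4 → S × T, tildeKernel β ν.fst (z i).1 (z j).1
      * tildeKernel β ν.snd (z i).2 (z j).2 ∂(Measure.pi fun _ => ν) = dcovTilde β ν := by
  have hm : Measurable (tildeIntegrand β ν) :=
    ((measurable_tildeKernel (m := ν.fst) hβ).comp
      (by fun_prop : Measurable fun p : (S × T) × (S × T) => (p.1.1, p.2.1))).mul
    ((measurable_tildeKernel (m := ν.snd) hβ).comp
      (by fun_prop : Measurable fun p : (S × T) × (S × T) => (p.1.2, p.2.2)))
  rw [dcovTilde, ← map_eval_pair_pi ν hij, integral_map (by fun_prop) hm.aestronglyMeasurable]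
  rfl

/-- Coordinate `j` enters only the first factor, so integrating it out first by Fubini leaves a
centred kernel averaged in one variable, which is zero. -/
lemma integral_tildeKernel_mul_eq_zero (hβ : 0 < β)
    (hx : Integrable (fun z : S × T => momentWeight β x₀ z.1 ^ 2) ν)
    (hy : Integrable (fun z : S × T => momentWeight β y₀ z.2 ^ 2) ν)
    {i j k l : Fin 4} (hij : i ≠ j) (hkl : k ≠ l) (hkj : k ≠ j) (hlj : l ≠ j) :
    ∫ z : Fin 4 → S × T, tildeKernel β ν.fst (z i).1 (z j).1
      * tildeKernel β ν.snd (z k).2 (z l).2 ∂(Measure.pi fun _ => ν) = 0 := by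
  have hint := integrable_tildeKernel_mul hβ hx hy hij hkl
  obtain ⟨i, rfl⟩ := Fin.exists_succAbove_eq hij
  obtain ⟨k, rfl⟩ := Fin.exists_succAbove_eq hkj
  obtain ⟨l, rfl⟩ := Fin.exists_succAbove_eq hlj
  have mp := (measurePreserving_piFinSuccAbove (fun _ : Fin 4 => ν) j).symm
  rw [← mp.integrable_comp_emb (MeasurableEquiv.measurableEmbedding _)] at hint
  rw [← mp.integral_comp']
  simp only [Function.comp_def, MeasurableEquiv.piFinSuccAbove_symm_apply, Fin.insertNthEquiv,
    Equiv.coe_fn_mk, Fin.insertNth_apply_same, Fin.insertNth_apply_succAbove] at hint ⊢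
  rw [integral_prod_symm _ hint]
  refine integral_eq_zero_of_ae (.of_forall fun w => ?_)
  simp only [Pi.zero_apply]
  rw [integral_mul_const]
  have h := integral_tildeKernel_right hβ (integrable_momentWeight_sq_fst hβ hx) (w i).1
  have hm : Measurable fun y => tildeKernel β ν.fst (w i).1 y :=
    (measurable_tildeKernel (m := ν.fst) hβ).comp
      (by fun_prop : Measurable fun y => ((w i).1, y))
  have h' : ∫ t : S × T, tildeKernel β ν.fst (w i).1 t.1 ∂ν = 0 :=
    (integral_map measurable_fst.aemeasurable hm.aestronglyMeasurable).symm.trans h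
  rw [h', zero_mul]

/-- Each vertex lies on two consecutive edges of opposite sign, so the one-point terms cancel; the
constants cancel since the signs sum to zero. Addition in `Fin 4` wraps around and closes the cycle.
-/
lemma hatKernel_eq_sum_tildeKernel (m : Measure S) (x : Fin 4 → S) :
    hatKernel β x = ∑ e : Fin 4, (-1) ^ (e : ℕ) * tildeKernel β m (x e) (x (e + 1)) := by
  simp [Fin.sum_univ_four, hatKernel, tildeKernel]
  ring

/-- The two forms of the distance covariance agree. -/
lemma dcovHat_eq_dcovTilde (hβ : 0 < β)
    (hx : Integrable (fun z : S × T => momentWeight β x₀ z.1 ^ 2) ν)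
    (hy : Integrable (fun z : S × T => momentWeight β y₀ z.2 ^ 2) ν) :
    dcovHat β ν = dcovTilde β ν := by
  have hne (e : Fin 4) : e ≠ e + 1 := by decide +revert
  have hne2 (e : Fin 4) : e + 1 + 1 ≠ e := by decide +revert
  have hterm (e e' : Fin 4) : ∫ z : Fin 4 → S × T, tildeKernel β ν.fst (z e).1 (z (e + 1)).1
      * tildeKernel β ν.snd (z e').2 (z (e' + 1)).2 ∂(Measure.pi fun _ => ν)
      = if e = e' then dcovTilde β ν else 0 := by
    split_ifs with h
    · subst h
      exact integral_tildeKernel_mul_self hβ (hne e)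
    -- Distinct edges: a vertex of the first edge off the second is integrated out. It is `e + 1`,
    -- unless the second edge starts there; then symmetry of the kernel lets `e` take that role.
    by_cases h' : e + 1 = e'
    · subst h'
      have hc (z : Fin 4 → S × T) := tildeKernel_comm (β := β) (m := ν.fst) (z e).1 (z (e + 1)).1
      simp only [hc]
      exact integral_tildeKernel_mul_eq_zero hβ hx hy (hne e).symm (hne _)
        (hne e).symm (hne2 e)
    · exact integral_tildeKernel_mul_eq_zero hβ hx hy (hne e) (hne _) (Ne.symm h')
        (fun h2 => h (add_right_cancel h2).symm)
  have hexp (z : Fin 4 → S × T) : hatIntegrand β z = ∑ e : Fin 4, ∑ e' : Fin 4,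
      ((-1) ^ (e : ℕ) * (-1) ^ (e' : ℕ)) * (tildeKernel β ν.fst (z e).1 (z (e + 1)).1
        * tildeKernel β ν.snd (z e').2 (z (e' + 1)).2) := by
    rw [hatIntegrand, hatKernel_eq_sum_tildeKernel ν.fst, hatKernel_eq_sum_tildeKernel ν.snd,
      Finset.sum_mul_sum]
    exact Finset.sum_congr rfl fun e _ => Finset.sum_congr rfl fun e' _ => by ring
  have hI (e e' : Fin 4) := (integrable_tildeKernel_mul hβ hx hy (hne e) (hne e')).const_mul
    ((-1) ^ (e : ℕ) * (-1) ^ (e' : ℕ))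
  rw [dcovHat, integral_congr_ae (.of_forall hexp),
    integral_finsetSum _ fun e _ => integrable_finsetSum _ fun e' _ => hI e e']
  have : ∀ e : Fin 4, ∫ z : Fin 4 → S × T, ∑ e' : Fin 4,
      ((-1) ^ (e : ℕ) * (-1) ^ (e' : ℕ)) * (tildeKernel β ν.fst (z e).1 (z (e + 1)).1
        * tildeKernel β ν.snd (z e').2 (z (e' + 1)).2) ∂(Measure.pi fun _ => ν)
      = dcovTilde β ν := by
    intro e
    rw [integral_finsetSum _ fun e' _ => hI e e']
    simp only [integral_const_mul, hterm]
    simp [← mul_pow]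
  simp [this]

theorem dcovWellDefined_of_integrable_sq (hβ : 0 < β)
    (hx : Integrable (fun z : S × T => momentWeight β x₀ z.1 ^ 2) ν)
    (hy : Integrable (fun z : S × T => momentWeight β y₀ z.2 ^ 2) ν) : DcovWellDefined β ν :=
  ⟨integrable_hatIntegrand hβ hx hy, integrable_tildeIntegrand hβ hx hy,
    dcovHat_eq_dcovTilde hβ hx hy⟩

end joint

/-! ### Empirical measures: strong law and weak convergence -/

section empirical

variable {E : Type*} [MeasurableSpace E]

lemma isProbabilityMeasure_empiricalMeasure (z : ℕ → E) {n : ℕ} (hn : n ≠ 0) :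
    IsProbabilityMeasure (empiricalMeasure z n) := by
  constructor
  simp only [empiricalMeasure, Measure.smul_apply, Measure.finsetSum_apply, measure_univ,
    Finset.sum_const, Finset.card_range, nsmul_eq_mul, mul_one, smul_eq_mul]
  exact ENNReal.inv_mul_cancel (by simpa using hn) (by simp)

lemma integrable_empiricalMeasure (z : ℕ → E) (n : ℕ) {f : E → ℝ} (hf : Measurable f) :
    Integrable f (empiricalMeasure z n) := by
  rcases eq_or_ne n 0 with rfl | hn
  · simp [empiricalMeasure]
  refine Integrable.smul_measure ?_ (by simpa using hn)
  refine integrable_finsetSum_measure.2 fun i _ => ?_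
  refine ⟨hf.aestronglyMeasurable, ?_⟩
  rw [HasFiniteIntegral, lintegral_dirac' _ hf.enorm]
  simp

lemma integral_empiricalMeasure (z : ℕ → E) (n : ℕ) {f : E → ℝ} (hf : Measurable f) :
    ∫ x, f x ∂(empiricalMeasure z n) = (n : ℝ)⁻¹ • ∑ i ∈ Finset.range n, f (z i) := by
  rw [empiricalMeasure, integral_smul_measure, integral_finsetSum_measure]
  · simp [integral_dirac' _ _ hf.stronglyMeasurable]
  · intro i _
    refine ⟨hf.aestronglyMeasurable, ?_⟩
    rw [HasFiniteIntegral, lintegral_dirac' _ hf.enorm]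
    simp

variable {Ω : Type*} [MeasurableSpace Ω] {P : Measure Ω} {μ : Measure E} {Z : ℕ → Ω → E}

theorem ae_tendsto_integral_empiricalMeasure (hlaw : ∀ i, HasLaw (Z i) μ P)
    (hindep : iIndepFun Z P) {f : E → ℝ} (hf : Measurable f) (hint : Integrable f μ) :
    ∀ᵐ ω ∂P, Tendsto (fun n => ∫ x, f x ∂(empiricalMeasure (fun i => Z i ω) n)) atTop
      (𝓝 (∫ x, f x ∂μ)) := by
  have h := strong_law_ae (μ := P) (fun i ω => f (Z i ω))
    ((integrable_map_measure (by rw [(hlaw 0).map_eq]; exact hint.aestronglyMeasurable)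
      (hlaw 0).aemeasurable).1 (by rw [(hlaw 0).map_eq]; exact hint))
    (fun i j hij => (hindep.indepFun hij).comp hf hf)
    (fun i => (IdentDistrib.mk (hlaw i).aemeasurable (hlaw 0).aemeasurable
      ((hlaw i).map_eq.trans (hlaw 0).map_eq.symm)).comp hf)
  have e : ∫ ω, f (Z 0 ω) ∂P = ∫ x, f x ∂μ := by
    rw [← (hlaw 0).map_eq, integral_map (hlaw 0).aemeasurable]
    rw [(hlaw 0).map_eq]; exact hint.aestronglyMeasurable
  rw [e] at h
  simpa only [integral_empiricalMeasure _ _ hf] using h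

/-- The empirical distribution of the first `n + 1` terms, as a probability measure. -/
noncomputable def empiricalProbabilityMeasure (z : ℕ → E) (n : ℕ) : ProbabilityMeasure E :=
  ⟨empiricalMeasure z (n + 1), isProbabilityMeasure_empiricalMeasure z n.succ_ne_zero⟩

/-- Varadarajan's theorem: the empirical distributions converge weakly almost surely. -/
theorem ae_tendsto_empiricalProbabilityMeasure [TopologicalSpace E] [SecondCountableTopology E]
    [OpensMeasurableSpace E] [IsProbabilityMeasure μ] (hlaw : ∀ i, HasLaw (Z i) μ P)
    (hindep : iIndepFun Z P) :
    ∀ᵐ ω ∂P, Tendsto (fun n => empiricalProbabilityMeasure (fun i => Z i ω) n) atTop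
      (𝓝 (⟨μ, ‹_›⟩ : ProbabilityMeasure E)) := by
  classical
  let b := TopologicalSpace.countableBasis E
  have : Countable b := TopologicalSpace.countable_countableBasis E |>.to_subtype
  -- Finite intersections of basic open sets form a countable π-system containing arbitrarily small
  -- neighbourhoods of every point. The strong law on each of them costs a single null set.
  let U : Finset b → Set E := fun t => ⋂ s ∈ t, (s : Set E)
  have hU (t) : MeasurableSet (U t) := t.measurableSet_biInter fun s _ =>
    (TopologicalSpace.isOpen_of_mem_countableBasis s.2).measurableSet
  have key : ∀ᵐ ω ∂P, ∀ t : Finset b,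
      Tendsto (fun n => ∫ x, (U t).indicator 1 x ∂(empiricalMeasure (fun i => Z i ω) n)) atTop
        (𝓝 (∫ x, (U t).indicator (1 : E → ℝ) x ∂μ)) :=
    ae_all_iff.2 fun t => ae_tendsto_integral_empiricalMeasure hlaw hindep
      (measurable_one.indicator (hU t)) ((integrable_const (1 : ℝ)).indicator (hU t))
  filter_upwards [key] with ω hω
  refine IsPiSystem.tendsto_probabilityMeasure_of_tendsto_of_mem (S := Set.range U) ?_ ?_ ?_ ?_
  · rintro _ ⟨s, rfl⟩ _ ⟨t, rfl⟩ _
    exact ⟨s ∪ t, by simp only [U]; exact Finset.iInf_union⟩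
  · rintro _ ⟨t, rfl⟩
    exact hU t
  · intro u hu x hx
    obtain ⟨v, hv, hxv, hvu⟩ :=
      (TopologicalSpace.isBasis_countableBasis E).exists_subset_of_mem_open hx hu
    refine ⟨v, ⟨{(⟨v, hv⟩ : b)}, ?_⟩, ?_, hvu⟩
    · exact Finset.iInf_singleton (⟨v, hv⟩ : b) fun s => (s : Set E)
    · exact (TopologicalSpace.isOpen_of_mem_countableBasis hv).mem_nhds hxv
  · rintro _ ⟨t, rfl⟩
    have h := (tendsto_add_atTop_iff_nat 1).2 (hω t)
    simp only [integral_indicator_one (hU t)] at h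
    rw [← NNReal.tendsto_coe]
    exact h

end empirical

/-! ### Dominated convergence along weak limits -/

section domination

variable {X : Type*} [TopologicalSpace X] [MeasurableSpace X] [OpensMeasurableSpace X]
  [HasOuterApproxClosed X] {μ : ProbabilityMeasure X} {μs : ℕ → ProbabilityMeasure X}

/-- Lower semicontinuity from the portmanteau theorem for open sets. Negative `c` is split off
because the argument runs through `ENNReal.ofReal`. -/
lemma eventually_lt_integral_of_tendsto (hμ : Tendsto μs atTop (𝓝 μ)) {h : X → ℝ}
    (hc : Continuous h) (h0 : 0 ≤ h) (hi : Integrable h (μ : Measure X))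
    (his : ∀ n, Integrable h (μs n : Measure X)) {c : ℝ} (hcl : c < ∫ x, h x ∂(μ : Measure X)) :
    ∀ᶠ n in atTop, c < ∫ x, h x ∂(μs n : Measure X) := by
  rcases lt_or_ge c 0 with hc0 | hc0
  · exact Eventually.of_forall fun n => hc0.trans_le (integral_nonneg h0)
  have h1 := lintegral_le_liminf_lintegral_of_forall_isOpen_measure_le_liminf_measure
    (μ := (μ : Measure X)) (μs := fun n => (μs n : Measure X)) hc h0
    fun G hG => ProbabilityMeasure.le_liminf_measure_open_of_tendsto hμ hG
  rw [← ofReal_integral_eq_lintegral_ofReal hi (Eventually.of_forall h0)] at h1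
  have h2 : ENNReal.ofReal c < ENNReal.ofReal (∫ x, h x ∂(μ : Measure X)) :=
    (ENNReal.ofReal_lt_ofReal_iff (hc0.trans_lt hcl)).2 hcl
  filter_upwards [eventually_lt_of_lt_liminf (h2.trans_le h1)] with n hn
  rw [← ofReal_integral_eq_lintegral_ofReal (his n) (Eventually.of_forall h0)] at hn
  exact (ENNReal.ofReal_lt_ofReal_iff_of_nonneg hc0).1 hn

/-- Dominated convergence along a weakly convergent sequence of probability measures. -/
theorem tendsto_integral_of_dominated_of_tendsto (hμ : Tendsto μs atTop (𝓝 μ)) {f G : X → ℝ}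
    (hf : Continuous f) (hG : Continuous G) (hfG : ∀ x, |f x| ≤ G x)
    (hi : Integrable G (μ : Measure X)) (his : ∀ n, Integrable G (μs n : Measure X))
    (hlim : Tendsto (fun n => ∫ x, G x ∂(μs n : Measure X)) atTop
      (𝓝 (∫ x, G x ∂(μ : Measure X)))) :
    Tendsto (fun n => ∫ x, f x ∂(μs n : Measure X)) atTop (𝓝 (∫ x, f x ∂(μ : Measure X))) := by
  have lower : ∀ f : X → ℝ, Continuous f → (∀ x, |f x| ≤ G x) →
      ∀ a < ∫ x, f x ∂(μ : Measure X), ∀ᶠ n in atTop, a < ∫ x, f x ∂(μs n : Measure X) := by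
    intro f hf hfG a ha
    have fi (m : ProbabilityMeasure X) (hm : Integrable G (m : Measure X)) :
        Integrable f (m : Measure X) :=
      hm.mono' hf.aestronglyMeasurable (Eventually.of_forall hfG)
    -- Lower semicontinuity for `G + f ≥ 0`, after which the convergent integral of `G` is
    -- subtracted. Each estimate gives up half of the gap `∫ f - a`, so exactly `a` remains.
    have h1 := eventually_lt_integral_of_tendsto hμ (h := fun x => G x + f x) (hG.add hf)
      (fun x => by have := neg_abs_le (f x); have := hfG x; simp only [Pi.zero_apply]; linarith)
      (hi.add (fi _ hi)) (fun n => (his n).add (fi _ (his n)))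
      (c := ∫ x, G x ∂(μ : Measure X) + (a + ∫ x, f x ∂(μ : Measure X)) / 2)
      (by rw [integral_add hi (fi _ hi)]; linarith)
    have h2 := hlim.eventually_lt_const (u := ∫ x, G x ∂(μ : Measure X)
      + (∫ x, f x ∂(μ : Measure X) - a) / 2) (by linarith)
    filter_upwards [h1, h2] with n hn1 hn2
    rw [integral_add (his n) (fi _ (his n))] at hn1
    linarith
  refine tendsto_order.2 ⟨lower f hf hfG, fun a ha => ?_⟩
  -- The upper bound is the lower bound for `-f`.
  have h := lower (fun x => -f x) hf.neg (by simpa using hfG) (-a)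
    (by rw [integral_neg]; linarith)
  filter_upwards [h] with n hn
  rw [integral_neg] at hn
  linarith

end domination

/-! ### Strong consistency -/

section consistency

variable {S T : Type*} [MetricSpace S] [SecondCountableTopology S] [MeasurableSpace S]
  [BorelSpace S] [MetricSpace T] [SecondCountableTopology T] [MeasurableSpace T] [BorelSpace T]
  {β : ℝ} {x₀ : S} {y₀ : T} {μ : Measure (S × T)} [IsProbabilityMeasure μ]
  {Ω : Type*} [MeasurableSpace Ω] {P : Measure Ω} {Z : ℕ → Ω → S × T}

lemma integrable_one_add_rpow {E : Type*} [MeasurableSpace E] {m : Measure E} [IsFiniteMeasure m]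
    {f : E → ℝ} (hf : Measurable f) (h0 : ∀ x, 0 ≤ f x) {p : ℝ} (hp : 0 ≤ p)
    (hi : Integrable (fun x => f x ^ p) m) : Integrable (fun x => (1 + f x) ^ p) m := by
  refine (((integrable_const (1 : ℝ)).add hi).const_mul (2 ^ p)).mono'
    ((hf.const_add 1).pow_const p).aestronglyMeasurable (.of_forall fun x => ?_)
  have hx := h0 x
  have hx' := Real.rpow_nonneg hx p
  have h2 : (0 : ℝ) ≤ 2 ^ p := by positivity
  rw [Real.norm_of_nonneg (by positivity)]
  simp only [Pi.add_apply]
  rcases le_total (f x) 1 with h | h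
  · calc (1 + f x) ^ p ≤ 2 ^ p := Real.rpow_le_rpow (by linarith) (by linarith) hp
      _ ≤ _ := by nlinarith
  · calc (1 + f x) ^ p ≤ (2 * f x) ^ p := Real.rpow_le_rpow (by linarith) (by linarith) hp
      _ = 2 ^ p * f x ^ p := Real.mul_rpow (by norm_num) hx
      _ ≤ _ := by nlinarith

theorem ae_tendsto_dcovHat (hβ : 0 < β) (hlaw : ∀ i, HasLaw (Z i) μ P) (hindep : iIndepFun Z P)
    (hx : Integrable (fun z : S × T => momentWeight β x₀ z.1 ^ 2) μ)
    (hy : Integrable (fun z : S × T => momentWeight β y₀ z.2 ^ 2) μ) :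
    ∀ᵐ ω ∂P, Tendsto (fun n : ℕ => dcovHat β (empiricalMeasure (fun i => Z i ω) n))
      atTop (𝓝 (dcovHat β μ)) := by
  have hgc : Continuous fun z : S × T => momentWeight β x₀ z.1 * momentWeight β y₀ z.2 :=
    ((continuous_momentWeight hβ x₀).comp continuous_fst).mul
      ((continuous_momentWeight hβ y₀).comp continuous_snd)
  have hg := integrable_momentWeight_mul hβ hx hy
  filter_upwards [ae_tendsto_empiricalProbabilityMeasure hlaw hindep,
    ae_tendsto_integral_empiricalMeasure hlaw hindep hgc.measurable hg] with ω hω hgω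
  -- The shift avoids `n = 0`, where the empirical measure is zero and not a probability measure.
  rw [← tendsto_add_atTop_iff_nat 1] at hgω ⊢
  have hpi := ((ProbabilityMeasure.continuous_pi (ι := Fin 4) (α := fun _ => S × T)).tendsto
    fun _ => ⟨μ, ‹_›⟩).comp (tendsto_pi_nhds.2 fun _ => hω)
  have hprob (n : ℕ) := isProbabilityMeasure_empiricalMeasure (fun i => Z i ω) n.succ_ne_zero
  refine (tendsto_integral_of_dominated_of_tendsto hpi (continuous_hatIntegrand hβ)
    (G := fun z => kernelConst β ^ 2 *
      ∏ i, (momentWeight β x₀ (z i).1 * momentWeight β y₀ (z i).2))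
    (continuous_const.mul (continuous_finsetProd _ fun i _ => hgc.comp (continuous_apply i)))
    (abs_hatIntegrand_le hβ x₀ y₀) ?_ ?_ ?_).const_mul (1 / 4)
  · exact (Integrable.fintype_prod fun _ => hg).const_mul _
  · intro n
    have := hprob n
    exact (Integrable.fintype_prod (μ := fun _ : Fin 4 => empiricalMeasure (fun i => Z i ω) (n + 1))
      fun _ => integrable_empiricalMeasure _ _ hgc.measurable).const_mul _
  -- The dominating function factorises over the four coordinates, so its integral is a fourth power
  -- to which the strong law for `g` applies.
  · have e (m : Measure (S × T)) [IsProbabilityMeasure m] : ∫ z : Fin 4 → S × T,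
        kernelConst β ^ 2 * ∏ i, (momentWeight β x₀ (z i).1 * momentWeight β y₀ (z i).2)
          ∂(Measure.pi fun _ => m) = kernelConst β ^ 2 *
            (∫ z, momentWeight β x₀ z.1 * momentWeight β y₀ z.2 ∂m) ^ 4 := by
      rw [integral_const_mul, integral_fintype_prod_eq_pow (ι := Fin 4)
        fun z : S × T => momentWeight β x₀ z.1 * momentWeight β y₀ z.2]
      rfl
    have h := (hgω.pow 4).const_mul (kernelConst β ^ 2)
    rw [← e μ] at h
    refine h.congr fun n => ?_
    have := hprob n
    exact (e _).symm

theorem dcov_strongly_consistent (hβ : 0 < β) (hlaw : ∀ i, HasLaw (Z i) μ P)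
    (hindep : iIndepFun Z P)
    (hx : Integrable (fun z : S × T => dist z.1 x₀ ^ betaStar β) μ)
    (hy : Integrable (fun z : S × T => dist z.2 y₀ ^ betaStar β) μ) :
    DcovWellDefined β μ ∧
      (∀ᵐ ω ∂P, Tendsto (fun n : ℕ => dcovHat β (empiricalMeasure (fun i => Z i ω) n))
        atTop (𝓝 (dcovHat β μ))) ∧
      (∀ᵐ ω ∂P, Tendsto (fun n : ℕ => dcovTilde β (empiricalMeasure (fun i => Z i ω) n))
        atTop (𝓝 (dcovTilde β μ))) := by
  have hb : 0 ≤ betaStar β := hβ.le.trans (le_betaStar β)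
  have hx' : Integrable (fun z : S × T => momentWeight β x₀ z.1 ^ 2) μ := by
    simp only [momentWeight_sq]
    exact integrable_one_add_rpow (by fun_prop) (fun _ => dist_nonneg) hb hx
  have hy' : Integrable (fun z : S × T => momentWeight β y₀ z.2 ^ 2) μ := by
    simp only [momentWeight_sq]
    exact integrable_one_add_rpow (by fun_prop) (fun _ => dist_nonneg) hb hy
  have hlim := ae_tendsto_dcovHat hβ hlaw hindep hx' hy'
  refine ⟨dcovWellDefined_of_integrable_sq hβ hx' hy', hlim, ?_⟩
  rw [← dcovHat_eq_dcovTilde hβ hx' hy']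
  filter_upwards [hlim] with ω hω
  refine hω.congr' ?_
  -- For `n ≠ 0` the empirical measure is a probability measure integrating every measurable real
  -- function, so the two forms agree for it too.
  filter_upwards [eventually_ne_atTop 0] with n hn
  have := isProbabilityMeasure_empiricalMeasure (fun i => Z i ω) hn
  have hX : Measurable fun z : S × T => momentWeight β x₀ z.1 ^ 2 :=
    (((continuous_momentWeight hβ x₀).comp continuous_fst).pow 2).measurable
  have hY : Measurable fun z : S × T => momentWeight β y₀ z.2 ^ 2 :=
    (((continuous_momentWeight hβ y₀).comp continuous_snd).pow 2).measurable
  exact dcovHat_eq_dcovTilde hβ (integrable_empiricalMeasure _ _ hX)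
    (integrable_empiricalMeasure _ _ hY)

end consistency

theorem mainTheorem3 {S T : Type*}
    [MetricSpace S] [TopologicalSpace.SeparableSpace S] [MeasurableSpace S] [BorelSpace S]
    [MetricSpace T] [TopologicalSpace.SeparableSpace T] [MeasurableSpace T] [BorelSpace T]
    (μ : Measure (S × T)) [IsProbabilityMeasure μ] (x₀ : S) (y₀ : T)
    {Ω : Type*} [MeasurableSpace Ω] (P : Measure Ω) [IsProbabilityMeasure P]
    (Z : ℕ → Ω → S × T) (hlaw : ∀ i, HasLaw (Z i) μ P) (hindep : iIndepFun Z P) :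
    (∀ β : ℝ, 0 < β →
      Integrable (fun z : S × T => dist z.1 x₀ ^ betaStar β) μ →
      Integrable (fun z : S × T => dist z.2 y₀ ^ betaStar β) μ →
      DcovWellDefined β μ ∧
      (∀ᵐ ω ∂P, Tendsto (fun n : ℕ => dcovHat β (empiricalMeasure (fun i => Z i ω) n))
        atTop (𝓝 (dcovHat β μ))) ∧
      (∀ᵐ ω ∂P, Tendsto (fun n : ℕ => dcovTilde β (empiricalMeasure (fun i => Z i ω) n))
        atTop (𝓝 (dcovTilde β μ)))) ∧
    (Integrable (fun z : S × T => dist z.1 x₀) μ →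
      Integrable (fun z : S × T => dist z.2 y₀) μ →
      DcovWellDefined 1 μ ∧
      (∀ᵐ ω ∂P, Tendsto (fun n : ℕ => dcovHat 1 (empiricalMeasure (fun i => Z i ω) n))
        atTop (𝓝 (dcovHat 1 μ))) ∧
      (∀ᵐ ω ∂P, Tendsto (fun n : ℕ => dcovTilde 1 (empiricalMeasure (fun i => Z i ω) n))
        atTop (𝓝 (dcovTilde 1 μ)))) := by
  have : SecondCountableTopology S := UniformSpace.secondCountable_of_separable S
  have : SecondCountableTopology T := UniformSpace.secondCountable_of_separable T
  refine ⟨fun β hβ hx hy => dcov_strongly_consistent hβ hlaw hindep hx hy, fun hx hy => ?_⟩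
  have h1 : betaStar 1 = 1 := by norm_num [betaStar]
  exact dcov_strongly_consistent (x₀ := x₀) (y₀ := y₀) one_pos hlaw hindep
    (by simpa only [h1, Real.rpow_one] using hx) (by simpa only [h1, Real.rpow_one] using hy)
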